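/- **Theorem.** Let $(X,d)$ be a metric space and let $\omega$ be a non-principal ultrafilter on $\mathbb N$ (an ultrafilter containing no finite set). The following are equivalent. 1. $(X,d)$ is biLipschitz equivalent to a snowflake. 2. No $\omega$-limit of $(X,d)$ contains a non-constant rectifiable curve. 3. No $\omega$-limit of $(X,d)$ contains a non-constant geodesic. 4. There exist an integer $k\ge 2$ and real numbers $\varepsilon,\alpha>0$ such that $(X,d)$ satisfies $\mathrm{SRA}_k(\varepsilon,\alpha)$. 5. $(X,d)$ is not line-fitting. Moreover, each of the conditions 1–5 (for the given $\omega$) is preserved under biLipschitz equivalence: if $X$ and $Y$ are biLipschitz equivalent metric spaces, then each condition holds for $X$ if and only if it holds for $Y$. Here the following terminology is used. * Metric spaces $(X,d)$ and $(Y,d')$ are *biLipschitz equivalent* if there are a surjective map $f:X\to Y$ and $C\ge1$ with $C^{-1}d(x,x')\le d'(f(x),f(x'))\le C\,d(x,x')$ for all $x,x'\in X$. A *snowflake* is a metric space of the form $(Y,\rho^{\alpha})$ with $(Y,\rho)$ a metric space and $\alpha\in(0,1)$. * An *$\omega$-limit* of $(X,d)$ is the $\omega$-limit of the pointed metric spaces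 $(X,r_nd,x_n)$ for some sequence of points $x_n\in X$ and of real numbers $r_n>0$. It is the set of all sequences $(y_n)$ in $X$ with $\omega\text{-}\lim r_nd(x_n,y_n)<\infty$, where $(y_n)$ and $(z_n)$ are identified when $\omega\text{-}\lim r_nd(y_n,z_n)=0$, endowed with the metric induced by $\omega\text{-}\lim r_nd(y_n,z_n)$. * A curve in a metric space is a continuous map $\gamma$ from $[0,1]$ to it. It is *rectifiable* if its length is finite, and a *geodesic* if the distance between $\gamma(t)$ and $\gamma(s)$ equals $|t-s|$ times the distance between $\gamma(0)$ and $\gamma(1)$ for all $t,s\in[0,1]$. * For $k\ge 2$ and $\varepsilon,\alpha>0$, $(X,d)$ satisfies $\mathrm{SRA}_k(\varepsilon,\alpha)$ if for all $x_1,\dots,x_k\in X$ with $\max_{1\le i\le k-1}d(x_i,x_{i+1})\le(1+\varepsilon)\min_{1\le i\le k-1}d(x_i,x_{i+1})$ one has $\sum_{i=1}^{k-1}d(x_i,x_{i+1})\ge(1+\alpha)\,d(x_1,x_k)$. * $(X,d)$ is *line-fitting* if for every integer $n\ge1$ there is a metric $d_n$ on the disjoint union $X\sqcup[0,1]$ which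 restricts to the Euclidean metric on $[0,1]$ and to $c_nd$ on $X$ for some constant $c_n>0$, and such that every $t\in[0,1]$ satisfies $d_n(t,x)<\frac1n$ for some $x\in X$. -/

import Mathlib

open Filter Topology

universe u v

noncomputable section

namespace SnowflakeChar

/-! ### BiLipschitz equivalence and snowflakes -/

/-- Two metric spaces are biLipschitz equivalent if there is a surjective biLipschitz map from
the first one onto the second one. -/
def BiLipschitzEquivalent (X : Type u) (Y : Type v) [MetricSpace X] [MetricSpace Y] : Prop :=
  ∃ f : X → Y, Function.Surjective f ∧ ∃ C : ℝ, 1 ≤ C ∧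
    ∀ x x' : X, C⁻¹ * dist x x' ≤ dist (f x) (f x') ∧ dist (f x) (f x') ≤ C * dist x x'

/-- A metric space `(Z, d)` is a snowflake if there are `α ∈ (0, 1)` and a metric space `(Y, ρ)`
with `(Z, d) = (Y, ρ ^ α)`. -/
def IsSnowflake (Z : Type u) [MetricSpace Z] : Prop :=
  ∃ (α : ℝ) (h₀ : 0 < α) (h₁ : α < 1) (Y : Type u) (_ : MetricSpace Y),
    Nonempty (Z ≃ᵢ Metric.Snowflaking Y α h₀ h₁.le)

/-- `X` is biLipschitz equivalent to a snowflake. -/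
def BiLipschitzToSnowflake (X : Type u) [MetricSpace X] : Prop :=
  ∃ (Z : Type u) (_ : MetricSpace Z), IsSnowflake Z ∧ BiLipschitzEquivalent X Z

/-! ### Ultralimits -/

/-- An ultrafilter on `ℕ` is non-principal if no finite set belongs to it. -/
def IsNonprincipal (ω : Ultrafilter ℕ) : Prop :=
  ∀ A : Set ℕ, A.Finite → A ∉ ω

/-- A sequence `y` of points of pointed metric spaces `(X n, x n)` is `ω`-admissible if the
`ω`-limit of `dist (x n) (y n)` is finite. -/
def IsAdmissible (ω : Ultrafilter ℕ) {X : ℕ → Type u} [∀ n, MetricSpace (X n)]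
    (x y : ∀ n, X n) : Prop :=
  ∃ L : ℝ, Tendsto (fun n => dist (x n) (y n)) ω (𝓝 L)

/-- The `ω`-admissible sequences of a sequence of pointed metric spaces. -/
def AdmissibleSeq (ω : Ultrafilter ℕ) (X : ℕ → Type u) [∀ n, MetricSpace (X n)]
    (x : ∀ n, X n) : Type u :=
  {y : ∀ n, X n // IsAdmissible ω x y}

/-- The `ω`-limit of distances between two admissible sequences exists. -/
theorem AdmissibleSeq.tendsto_dist (ω : Ultrafilter ℕ) (X : ℕ → Type u) [∀ n, MetricSpace (X n)]
    (x : ∀ n, X n) (y z : AdmissibleSeq ω X x) :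
    Tendsto (fun n => dist (y.1 n) (z.1 n)) ω
      (𝓝 (limUnder (ω : Filter ℕ) fun n => dist (y.1 n) (z.1 n))) := by
  apply tendsto_nhds_limUnder
  obtain ⟨a, ha⟩ := y.2
  obtain ⟨b, hb⟩ := z.2
  have h1 : ∀ᶠ n in (ω : Filter ℕ), dist (x n) (y.1 n) < a + 1 :=
    ha.eventually (gt_mem_nhds (by linarith))
  have h2 : ∀ᶠ n in (ω : Filter ℕ), dist (x n) (z.1 n) < b + 1 :=
    hb.eventually (gt_mem_nhds (by linarith))
  have h3 : ∀ᶠ n in (ω : Filter ℕ),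
      dist (y.1 n) (z.1 n) ∈ Set.Icc (0 : ℝ) (a + 1 + (b + 1)) := by
    filter_upwards [h1, h2] with n hn1 hn2
    refine ⟨dist_nonneg, ?_⟩
    have := dist_triangle_left (y.1 n) (z.1 n) (x n)
    linarith
  obtain ⟨L, -, hL⟩ := (isCompact_Icc (a := (0 : ℝ)) (b := a + 1 + (b + 1))).ultrafilter_le_nhds
    (ω.map fun n => dist (y.1 n) (z.1 n)) (le_principal_iff.mpr h3)
  exact ⟨L, hL⟩

/-- Admissible sequences carry the pseudometric `ω-lim dist (y n) (z n)`. -/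
instance (ω : Ultrafilter ℕ) (X : ℕ → Type u) [∀ n, MetricSpace (X n)] (x : ∀ n, X n) :
    PseudoMetricSpace (AdmissibleSeq ω X x) where
  dist y z := limUnder (ω : Filter ℕ) fun n => dist (y.1 n) (z.1 n)
  dist_self y := by
    simp only [dist_self]
    exact tendsto_const_nhds.limUnder_eq
  dist_comm y z := by simp only [dist_comm]
  dist_triangle y z w := by
    exact le_of_tendsto_of_tendsto' (AdmissibleSeq.tendsto_dist ω X x y w)
      ((AdmissibleSeq.tendsto_dist ω X x y z).add (AdmissibleSeq.tendsto_dist ω X x z w))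
      fun n => dist_triangle _ _ _

/-- The `ω`-limit of the pointed metric spaces `(X n, x n)`: the quotient of the space of
admissible sequences by the relation `ω-lim dist (y n) (z n) = 0`, with the induced metric. -/
abbrev Ultralimit (ω : Ultrafilter ℕ) (X : ℕ → Type u) [∀ n, MetricSpace (X n)]
    (x : ∀ n, X n) : Type u :=
  SeparationQuotient (AdmissibleSeq ω X x)

/-- A copy of `X`, to be endowed with the metric `r * d`, as a one-field structure. -/
structure Rescaled (X : Type u) (r : Set.Ioi (0 : ℝ)) : Type u where
  /-- The underlying point of `X`. -/
  val : X

/-- The metric space `(X, r * d)`. -/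
instance (X : Type u) [MetricSpace X] (r : Set.Ioi (0 : ℝ)) : MetricSpace (Rescaled X r) where
  dist y z := r.1 * dist y.val z.val
  dist_self y := by rw [dist_self, mul_zero]
  dist_comm y z := by rw [dist_comm]
  dist_triangle y z w := by
    rw [← mul_add]
    exact mul_le_mul_of_nonneg_left (dist_triangle _ _ _) (le_of_lt r.2)
  eq_of_dist_eq_zero {y z} h := by
    obtain ⟨y⟩ := y
    obtain ⟨z⟩ := z
    have h' : y = z := dist_eq_zero.mp ((mul_eq_zero.mp h).resolve_left (ne_of_gt r.2))
    rw [h']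

/-- The `ω`-limit of `X` determined by the scales `r n > 0` and the base points `x n`, that is, the
`ω`-limit of the pointed metric spaces `(X, r n * d, x n)`. -/
abbrev OmegaLimit (ω : Ultrafilter ℕ) (X : Type u) [MetricSpace X] (r : ℕ → Set.Ioi (0 : ℝ))
    (x : ℕ → X) : Type u :=
  Ultralimit ω (fun n => Rescaled X (r n)) fun n => ⟨x n⟩

/-! ### Curves -/

/-- A curve is rectifiable if it has finite length. -/
def IsRectifiable {Y : Type u} [MetricSpace Y] (γ : C(unitInterval, Y)) : Prop :=
  eVariationOn γ Set.univ < ⊤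

/-- A geodesic, parametrized proportionally to arc length on `[0, 1]`. -/
def IsGeodesic {Y : Type u} [MetricSpace Y] (γ : C(unitInterval, Y)) : Prop :=
  ∀ t s : unitInterval, dist (γ t) (γ s) = |(t : ℝ) - s| * dist (γ 0) (γ 1)

/-- A curve is non-constant if it takes two different values. -/
def IsNonconstant {Y : Type u} [MetricSpace Y] (γ : C(unitInterval, Y)) : Prop :=
  ∃ t s : unitInterval, γ t ≠ γ s

/-- No `ω`-limit of `X` contains a non-constant rectifiable curve. -/
def NoRectifiableCurves (ω : Ultrafilter ℕ) (X : Type u) [MetricSpace X] : Prop :=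
  ∀ (r : ℕ → Set.Ioi (0 : ℝ)) (x : ℕ → X),
    ¬ ∃ γ : C(unitInterval, OmegaLimit ω X r x), IsRectifiable γ ∧ IsNonconstant γ

/-- No `ω`-limit of `X` contains a non-constant geodesic. -/
def NoGeodesics (ω : Ultrafilter ℕ) (X : Type u) [MetricSpace X] : Prop :=
  ∀ (r : ℕ → Set.Ioi (0 : ℝ)) (x : ℕ → X),
    ¬ ∃ γ : C(unitInterval, OmegaLimit ω X r x), IsGeodesic γ ∧ IsNonconstant γ

/-! ### Small rough angles for equally spaced points -/

/-- The condition `SRA_k(ε, α)`. The `k` points are `x 1, …, x k` (the other values of `x` play no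
role), and the hypothesis on them says that the largest of the distances `dist (x i) (x (i + 1))`,
`1 ≤ i ≤ k - 1`, is at most `1 + ε` times the smallest one. -/
def SRA (X : Type u) [MetricSpace X] (k : ℕ) (ε α : ℝ) : Prop :=
  ∀ x : ℕ → X,
    (∀ i ∈ Finset.Ico 1 k, ∀ j ∈ Finset.Ico 1 k,
      dist (x i) (x (i + 1)) ≤ (1 + ε) * dist (x j) (x (j + 1))) →
    (1 + α) * dist (x 1) (x k) ≤ ∑ i ∈ Finset.Ico 1 k, dist (x i) (x (i + 1))

/-- `SRA_k(ε, α)` holds for some `k ≥ 2` and `ε, α > 0`. At least two points are needed for the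
maximum and the minimum of the consecutive distances to make sense; for `k = 1` the inequality
would read `0 ≥ 0`. -/
def SatisfiesSomeSRA (X : Type u) [MetricSpace X] : Prop :=
  ∃ (k : ℕ) (ε α : ℝ), 2 ≤ k ∧ 0 < ε ∧ 0 < α ∧ SRA X k ε α

/-! ### Line-fitting spaces -/

/-- `X` is line-fitting if, for every positive integer `n`, there is a metric on the disjoint union
of `X` and `[0, 1]` which is Euclidean on `[0, 1]`, is a positive multiple of the given metric on
`X`, and for which `[0, 1]` lies in the open `1/n`-neighbourhood of `X`. -/
def LineFitting (X : Type u) [MetricSpace X] : Prop :=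
  ∀ n : ℕ, 1 ≤ n → ∃ D : MetricSpace (X ⊕ unitInterval),
    (∀ s t : unitInterval, D.dist (Sum.inr s) (Sum.inr t) = |(s : ℝ) - t|) ∧
    (∃ c : ℝ, 0 < c ∧ ∀ x y : X, D.dist (Sum.inl x) (Sum.inl y) = c * dist x y) ∧
    ∀ t : unitInterval, ∃ x : X, D.dist (Sum.inr t) (Sum.inl x) < 1 / (n : ℝ)

end SnowflakeChar

end

namespace SnowflakeChar

/-! Everything passes through `SatisfiesChainInequality`: for some `p > 1`, the `p`-th power of the
distance is subadditive along chains up to a constant. This says exactly that `d ^ p` is comparable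
to a metric (the infimum of chain sums), hence that `d` is biLipschitz to a snowflake. It is visibly
biLipschitz invariant, and it passes to ultralimits, where it kills rectifiable curves because `∑ d
^ p ≤ mesh ^ (p - 1) * length`.

In the other direction, line-fitting and the failure of every SRA condition both amount to
`HasApproxProgressions`, and such progressions yield a unit segment in an ultralimit. The hard step
is `satisfiesChainInequality_of_not_hasApproxProgressions`. Without approximate progressions, a path
from `x` to `y` of mesh at most `η * d(x, y)` has length at least `(1 + η) * d(x, y)`
(`exists_finePath_length_ge`). This gain at one scale is propagated to all scales by induction on
the number of steps of the chain, using the greedy coarsening `exists_finePath_of_chain`. -/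

/-! ### Chain inequalities and snowflakes. -/

/-- The snowflake inequality for chains: up to a multiplicative constant, the `p`-th power of the
distance is subadditive along finite chains. -/
def ChainInequality (X : Type u) [MetricSpace X] (p K : ℝ) : Prop :=
  ∀ (x : ℕ → X) (m : ℕ),
    dist (x 0) (x m) ^ p ≤ K * ∑ i ∈ Finset.range m, dist (x i) (x (i + 1)) ^ p

/-- `X` satisfies the chain inequality for some exponent `p > 1`. -/
def SatisfiesChainInequality (X : Type u) [MetricSpace X] : Prop :=
  ∃ p K : ℝ, 1 < p ∧ 0 < K ∧ ChainInequality X p K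

theorem ChainInequality.of_biLipschitz {X : Type u} {Y : Type v} [MetricSpace X] [MetricSpace Y]
    {p K C : ℝ} (hp : 0 < p) (hK : 0 < K) (hC : 0 < C) (f : X → Y)
    (hf : ∀ x x', C⁻¹ * dist x x' ≤ dist (f x) (f x') ∧ dist (f x) (f x') ≤ C * dist x x')
    (h : ChainInequality Y p K) : ChainInequality X p (C ^ p * K * C ^ p) := by
  intro x m
  have h1 : dist (x 0) (x m) ≤ C * dist (f (x 0)) (f (x m)) := by
    have := (hf (x 0) (x m)).1
    rwa [inv_mul_le_iff₀ hC] at this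
  calc dist (x 0) (x m) ^ p ≤ (C * dist (f (x 0)) (f (x m))) ^ p :=
        Real.rpow_le_rpow dist_nonneg h1 hp.le
    _ = C ^ p * dist (f (x 0)) (f (x m)) ^ p := Real.mul_rpow hC.le dist_nonneg
    _ ≤ C ^ p * (K * ∑ i ∈ Finset.range m, dist (f (x i)) (f (x (i + 1))) ^ p) := by
        gcongr
        exact h (fun i => f (x i)) m
    _ ≤ C ^ p * (K * ∑ i ∈ Finset.range m, C ^ p * dist (x i) (x (i + 1)) ^ p) := by
        gcongr with i
        rw [← Real.mul_rpow hC.le dist_nonneg]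
        exact Real.rpow_le_rpow dist_nonneg (hf _ _).2 hp.le
    _ = C ^ p * K * C ^ p * ∑ i ∈ Finset.range m, dist (x i) (x (i + 1)) ^ p := by
        rw [← Finset.mul_sum]; ring

theorem SatisfiesChainInequality.of_biLipschitz {X : Type u} {Y : Type v} [MetricSpace X]
    [MetricSpace Y] {C : ℝ} (hC : 0 < C) (f : X → Y)
    (hf : ∀ x x', C⁻¹ * dist x x' ≤ dist (f x) (f x') ∧ dist (f x) (f x') ≤ C * dist x x')
    (h : SatisfiesChainInequality Y) : SatisfiesChainInequality X := by
  obtain ⟨p, K, hp, hK, h⟩ := h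
  exact ⟨p, _, hp, by positivity, h.of_biLipschitz (by linarith) hK hC f hf⟩

theorem BiLipschitzEquivalent.satisfiesChainInequality_iff {X : Type u} {Y : Type v}
    [MetricSpace X] [MetricSpace Y] (h : BiLipschitzEquivalent X Y) :
    SatisfiesChainInequality X ↔ SatisfiesChainInequality Y := by
  obtain ⟨f, hs, C, hC, hf⟩ := h
  have hC0 : 0 < C := by linarith
  refine ⟨fun hX => ?_, fun hY => hY.of_biLipschitz hC0 f hf⟩
  -- Any section of a surjective biLipschitz map satisfies the same two bounds with the same `C`.
  refine hX.of_biLipschitz hC0 (Function.surjInv hs) fun y y' => ?_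
  have := hf (Function.surjInv hs y) (Function.surjInv hs y')
  simp only [Function.surjInv_eq hs] at this
  rw [inv_mul_le_iff₀ hC0] at this ⊢
  exact ⟨this.2, this.1⟩

/-- The power `α⁻¹` undoes the snowflaking, so with `p = α⁻¹` and `K = 1` the inequality is the
iterated triangle inequality of the original metric. -/
theorem IsSnowflake.satisfiesChainInequality {Z : Type u} [MetricSpace Z] (h : IsSnowflake Z) :
    SatisfiesChainInequality Z := by
  obtain ⟨α, h₀, h₁, Y, _, ⟨e⟩⟩ := h
  refine ⟨α⁻¹, 1, (one_lt_inv₀ h₀).2 h₁, one_pos, fun x m => ?_⟩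
  have key : ∀ z z' : Z, dist z z' ^ α⁻¹ = dist (e z).ofSnowflaking (e z').ofSnowflaking := by
    intro z z'
    rw [Metric.Snowflaking.dist_ofSnowflaking_ofSnowflaking, e.dist_eq]
  simp only [key, one_mul]
  exact dist_le_range_sum_dist (fun i => (e (x i)).ofSnowflaking) m

theorem BiLipschitzToSnowflake.satisfiesChainInequality {X : Type u} [MetricSpace X]
    (h : BiLipschitzToSnowflake X) : SatisfiesChainInequality X := by
  obtain ⟨Z, _, hZ, hXZ⟩ := h
  exact hXZ.satisfiesChainInequality_iff.2 hZ.satisfiesChainInequality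

theorem BiLipschitzToSnowflake.of_rpow_comparable {X Y : Type u} [MetricSpace X] [MetricSpace Y]
    {p K : ℝ} (hp : 1 < p) (hK : 0 < K) (e : X ≃ Y)
    (he : ∀ x x', dist (e x) (e x') ≤ dist x x' ^ p ∧ dist x x' ^ p ≤ K * dist (e x) (e x')) :
    BiLipschitzToSnowflake X := by
  have hp0 : 0 < p := by linarith
  have h₀ : 0 < p⁻¹ := inv_pos.2 hp0
  have h₁ : p⁻¹ < 1 := inv_lt_one_of_one_lt₀ hp
  refine ⟨Metric.Snowflaking Y p⁻¹ h₀ h₁.le, inferInstance,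
    ⟨p⁻¹, h₀, h₁, Y, inferInstance, ⟨IsometryEquiv.refl _⟩⟩,
    fun x => Metric.Snowflaking.toSnowflaking (e x),
    Metric.Snowflaking.toSnowflaking.surjective.comp e.surjective, max 1 (K ^ p⁻¹),
    le_max_left _ _, fun x x' => ?_⟩
  have hC : 0 < max 1 (K ^ p⁻¹) := by positivity
  rw [Metric.Snowflaking.dist_toSnowflaking_toSnowflaking, inv_mul_le_iff₀ hC]
  have hd : (dist x x' ^ p) ^ p⁻¹ = dist x x' := Real.rpow_rpow_inv dist_nonneg hp0.ne'
  constructor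
  · calc dist x x' = (dist x x' ^ p) ^ p⁻¹ := hd.symm
      _ ≤ (K * dist (e x) (e x')) ^ p⁻¹ :=
        Real.rpow_le_rpow (by positivity) (he x x').2 h₀.le
      _ = K ^ p⁻¹ * dist (e x) (e x') ^ p⁻¹ := Real.mul_rpow hK.le dist_nonneg
      _ ≤ _ := by gcongr; exact le_max_right _ _
  · calc dist (e x) (e x') ^ p⁻¹ ≤ (dist x x' ^ p) ^ p⁻¹ :=
        Real.rpow_le_rpow dist_nonneg (he x x').1 h₀.le
      _ = 1 * dist x x' := by rw [hd, one_mul]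
      _ ≤ _ := by gcongr; exact le_max_left _ _

/-- Translates the lists over which `PseudoMetricSpace.ofPreNNDist` takes its infimum into indexed
chains. -/
theorem exists_chain_sum_eq_zipWith_sum {X : Type u} (d : X → X → NNReal) (l : List X) (y : X) :
    ∀ x, ∃ (f : ℕ → X) (m : ℕ), f 0 = x ∧ f m = y ∧
      ((x :: l).zipWith d (l ++ [y])).sum = ∑ i ∈ Finset.range m, d (f i) (f (i + 1)) := by
  induction l with
  | nil => exact fun x => ⟨fun n => Nat.casesOn n x fun _ => y, 1, rfl, rfl, by simp⟩
  | cons a l ih =>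
    intro x
    obtain ⟨f, m, h0, hm, hs⟩ := ih a
    refine ⟨fun n => Nat.casesOn n x f, m + 1, rfl, hm, ?_⟩
    rw [Finset.sum_range_succ', add_comm]
    simp [hs, h0]

/-- A symmetric function that is subadditive along chains up to a constant is comparable to a
metric. -/
theorem exists_metricSpace_comparable {X : Type u} (d : X → X → NNReal) (hd0 : ∀ x, d x x = 0)
    (hdc : ∀ x y, d x y = d y x) (hd : ∀ x y, d x y = 0 → x = y) {K : NNReal} (hK : 0 < K)
    (h : ∀ (f : ℕ → X) (m : ℕ), d (f 0) (f m) ≤ K * ∑ i ∈ Finset.range m, d (f i) (f (i + 1))) :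
    ∃ M : MetricSpace X, ∀ x y, M.dist x y ≤ d x y ∧ d x y ≤ K * M.dist x y := by
  -- The infimum of chain sums is a pseudometric below `d`; `h` bounds every chain sum below by `d /
  -- K`, which also gives separation.
  let P : PseudoMetricSpace X := PseudoMetricSpace.ofPreNNDist d hd0 hdc
  have hge : ∀ x y, (d x y : ℝ) ≤ K * P.dist x y := fun x y => by
    have : d x y / K ≤ ⨅ l : List X, ((x :: l).zipWith d (l ++ [y])).sum := by
      refine le_ciInf fun l => ?_
      obtain ⟨f, m, rfl, rfl, hs⟩ := exists_chain_sum_eq_zipWith_sum d l y x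
      rw [hs, div_le_iff₀' hK]
      exact h f m
    rw [div_le_iff₀' hK] at this
    exact_mod_cast NNReal.coe_le_coe.2 this
  refine ⟨{ P with
    eq_of_dist_eq_zero := fun {x y} hxy => hd x y ?_ },
    fun x y => ⟨PseudoMetricSpace.dist_ofPreNNDist_le d hd0 hdc x y, hge x y⟩⟩
  have h1 := hge x y
  have h2 : P.dist x y = 0 := hxy
  rw [h2, mul_zero] at h1
  exact_mod_cast le_antisymm h1 (d x y).2

theorem SatisfiesChainInequality.biLipschitzToSnowflake {X : Type u} [hX : MetricSpace X]
    (h : SatisfiesChainInequality X) : BiLipschitzToSnowflake X := by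
  obtain ⟨p, K, hp, hK, h⟩ := h
  have hp0 : 0 < p := by linarith
  lift K to NNReal using hK.le
  obtain ⟨M, hM⟩ := exists_metricSpace_comparable (fun x y : X => nndist x y ^ p)
    (fun x => by simp [hp0.ne']) (fun x y => by simp only [nndist_comm])
    (fun x y hxy => by simpa [hp0.ne'] using hxy) (K := K) (by exact_mod_cast hK)
    (fun f m => by rw [← NNReal.coe_le_coe]; push_cast; exact h f m)
  refine @BiLipschitzToSnowflake.of_rpow_comparable X X hX M p K hp hK (Equiv.refl X)
    fun x y => ?_
  have := hM x y
  push_cast at this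
  exact this

theorem biLipschitzToSnowflake_iff {X : Type u} [MetricSpace X] :
    BiLipschitzToSnowflake X ↔ SatisfiesChainInequality X :=
  ⟨BiLipschitzToSnowflake.satisfiesChainInequality,
    SatisfiesChainInequality.biLipschitzToSnowflake⟩

/-! ### From the chain inequality to the absence of curves in ultralimits. -/

theorem ChainInequality.rescaled {X : Type u} [MetricSpace X] {p K : ℝ}
    (h : ChainInequality X p K) (r : Set.Ioi (0 : ℝ)) : ChainInequality (Rescaled X r) p K := by
  intro x m
  have hr : (0 : ℝ) < r.1 := r.2
  have key : ∀ y z : Rescaled X r, dist y z ^ p = r.1 ^ p * dist y.val z.val ^ p := fun y z =>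
    Real.mul_rpow hr.le dist_nonneg
  simp only [key, ← Finset.mul_sum]
  rw [mul_left_comm]
  gcongr
  exact h (fun i => (x i).val) m

theorem Ultralimit.tendsto_dist {ω : Ultrafilter ℕ} {X : ℕ → Type u} [∀ n, MetricSpace (X n)]
    {x : ∀ n, X n} (y z : AdmissibleSeq ω X x) :
    Tendsto (fun n => dist (y.1 n) (z.1 n)) ω
      (𝓝 (dist (SeparationQuotient.mk y : Ultralimit ω X x) (SeparationQuotient.mk z))) :=
  AdmissibleSeq.tendsto_dist ω X x y z

/-- Each instance involves finitely many distances, so it survives the `ω`-limit with the same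
constants. -/
theorem ChainInequality.ultralimit {ω : Ultrafilter ℕ} {X : ℕ → Type u} [∀ n, MetricSpace (X n)]
    {x : ∀ n, X n} {p K : ℝ} (hp : 0 < p) (h : ∀ n, ChainInequality (X n) p K) :
    ChainInequality (Ultralimit ω X x) p K := by
  intro u m
  obtain ⟨y, hy⟩ : ∃ y : ℕ → AdmissibleSeq ω X x, ∀ i, SeparationQuotient.mk (y i) = u i :=
    ⟨fun i => (SeparationQuotient.surjective_mk (u i)).choose,
      fun i => (SeparationQuotient.surjective_mk (u i)).choose_spec⟩
  simp only [← hy]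
  have hlim := fun i j => (Ultralimit.tendsto_dist (y i) (y j)).rpow_const (p := p) (Or.inr hp.le)
  exact le_of_tendsto_of_tendsto' (hlim 0 m)
    ((tendsto_finsetSum (Finset.range m) fun i _ => hlim i (i + 1)).const_mul K)
    fun n => h n (fun i => (y i).1 n) m

/-- Subdividing the curve into steps of length at most `ε` gives `∑ d ^ p ≤ ε ^ (p - 1) * length`,
which tends to `0` with `ε` since `p > 1`. -/
theorem ChainInequality.eq_of_isRectifiable {Y : Type u} [MetricSpace Y] {p K : ℝ} (hp : 1 < p)
    (hK : 0 < K) (h : ChainInequality Y p K) {γ : C(unitInterval, Y)} (hγ : IsRectifiable γ)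
    (t s : unitInterval) : γ t = γ s := by
  wlog hts : t ≤ s generalizing t s
  · exact (this s t (le_of_not_ge hts)).symm
  have hp0 : 0 < p := by linarith
  set V : ℝ := (eVariationOn γ Set.univ).toReal
  have hu : UniformContinuous γ := CompactSpace.uniformContinuous_of_continuous γ.continuous
  have key : ∀ ε > 0, dist (γ t) (γ s) ^ p ≤ K * (ε ^ (p - 1) * V) := by
    intro ε hε
    obtain ⟨δ, hδ, hδε⟩ := Metric.uniformContinuous_iff.1 hu ε hε
    obtain ⟨m, hm⟩ := exists_nat_one_div_lt hδ
    have hm0 : (0 : ℝ) < m + 1 := by positivity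
    have hle : (t : ℝ) ≤ s := hts
    have hst : (s : ℝ) - t ≤ 1 := by linarith [s.2.2, t.2.1]
    let w : ℕ → ℝ := fun i => t + i * ((s - t) / (m + 1))
    -- Clamping to `[0, 1]` keeps the samples valid and monotone for all `i : ℕ`, as
    -- `eVariationOn.sum_le` requires.
    let q : ℕ → unitInterval := fun i => Set.projIcc 0 1 zero_le_one (w i)
    have hw : Monotone w := by
      intro i j hij
      have : (0 : ℝ) ≤ (s - t) / (m + 1) := div_nonneg (by linarith) hm0.le
      dsimp only [w]
      gcongr
    have hq : Monotone q := (Set.monotone_projIcc zero_le_one).comp hw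
    have hq0 : q 0 = t := by simp [q, w]
    have hqm : q (m + 1) = s := by
      have : w (m + 1) = s := by
        simp only [w]; push_cast; field_simp; ring
      simp only [q, this, Set.projIcc_val]
    have hstep : ∀ i, dist (γ (q i)) (γ (q (i + 1))) ≤ ε := by
      intro i
      refine (hδε ?_).le
      have h1 : dist (q i) (q (i + 1)) ≤ dist (w i) (w (i + 1)) := by
        simpa using (LipschitzWith.projIcc zero_le_one).dist_le_mul (w i) (w (i + 1))
      refine h1.trans_lt (lt_of_le_of_lt ?_ hm)
      rw [dist_comm, Real.dist_eq]
      have : w (i + 1) - w i = (s - t) / (m + 1) := by simp only [w]; push_cast; ring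
      rw [this, abs_of_nonneg (div_nonneg (by linarith) hm0.le)]
      gcongr
    have hsum : ∑ i ∈ Finset.range (m + 1), dist (γ (q i)) (γ (q (i + 1))) ≤ V := by
      have h2 := eVariationOn.sum_le (f := γ) (s := Set.univ) (n := m + 1) hq
        (fun _ => Set.mem_univ _)
      have h3 := ENNReal.toReal_mono (ne_of_lt hγ) h2
      rw [ENNReal.toReal_sum fun _ _ => edist_ne_top _ _] at h3
      refine le_trans (le_of_eq (Finset.sum_congr rfl fun i _ => ?_)) h3
      rw [dist_comm, dist_edist]
    calc dist (γ t) (γ s) ^ p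
        = dist (γ (q 0)) (γ (q (m + 1))) ^ p := by rw [hq0, hqm]
      _ ≤ K * ∑ i ∈ Finset.range (m + 1), dist (γ (q i)) (γ (q (i + 1))) ^ p :=
        h (fun i => γ (q i)) (m + 1)
      _ ≤ K * ∑ i ∈ Finset.range (m + 1), ε ^ (p - 1) * dist (γ (q i)) (γ (q (i + 1))) := by
        gcongr with i
        have : dist (γ (q i)) (γ (q (i + 1))) ^ p =
            dist (γ (q i)) (γ (q (i + 1))) ^ (p - 1) * dist (γ (q i)) (γ (q (i + 1))) := by
          rw [← Real.rpow_add_one' dist_nonneg (by linarith), sub_add_cancel]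
        rw [this]
        exact mul_le_mul_of_nonneg_right (Real.rpow_le_rpow dist_nonneg (hstep i) (by linarith))
          dist_nonneg
      _ ≤ K * (ε ^ (p - 1) * V) := by rw [← Finset.mul_sum]; gcongr
  have hlim : Tendsto (fun ε : ℝ => K * (ε ^ (p - 1) * V)) (𝓝[>] 0) (𝓝 (K * (0 * V))) := by
    refine Tendsto.const_mul K (Tendsto.mul_const V ?_)
    have := (Real.continuousAt_rpow_const 0 (p - 1) (Or.inr (by linarith))).tendsto
    rw [Real.zero_rpow (by linarith)] at this
    exact this.mono_left nhdsWithin_le_nhds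
  have h0 : dist (γ t) (γ s) ^ p ≤ K * (0 * V) :=
    ge_of_tendsto hlim (eventually_nhdsWithin_of_forall key)
  rw [zero_mul, mul_zero] at h0
  exact dist_eq_zero.1 ((Real.rpow_eq_zero dist_nonneg hp0.ne').1
    (le_antisymm h0 (by positivity)))

theorem SatisfiesChainInequality.noRectifiableCurves {X : Type u} [MetricSpace X]
    (h : SatisfiesChainInequality X) (ω : Ultrafilter ℕ) : NoRectifiableCurves ω X := by
  obtain ⟨p, K, hp, hK, h⟩ := h
  rintro r x ⟨γ, hγ, t, s, hts⟩
  refine hts (ChainInequality.eq_of_isRectifiable hp hK ?_ hγ t s)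
  exact ChainInequality.ultralimit (by linarith) fun n => h.rescaled (r n)

theorem IsGeodesic.isRectifiable {Y : Type u} [MetricSpace Y] {γ : C(unitInterval, Y)}
    (h : IsGeodesic γ) : IsRectifiable γ := by
  have hL : LipschitzWith (nndist (γ 0) (γ 1)) γ := by
    refine LipschitzWith.of_dist_le_mul fun t s => ?_
    rw [h t s, mul_comm, Subtype.dist_eq, Real.dist_eq, coe_nndist]
  have h1 : eVariationOn γ Set.univ ≤
      nndist (γ 0) (γ 1) * eVariationOn (fun t : unitInterval => (t : ℝ)) Set.univ := by
    have := (LipschitzOnWith.comp_eVariationOn_le (f := γ) (C := nndist (γ 0) (γ 1))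
      (t := Set.univ) hL.lipschitzOnWith (g := fun t : unitInterval => t) (s := Set.univ)
      (fun _ _ => Set.mem_univ _))
    exact this
  refine h1.trans_lt (ENNReal.mul_lt_top ENNReal.coe_lt_top ?_)
  have hm : MonotoneOn (fun t : unitInterval => (t : ℝ)) Set.univ :=
    fun _ _ _ _ h => h
  have hI : Set.univ ∩ Set.Icc (0 : unitInterval) 1 = Set.univ := by
    rw [Set.univ_inter]
    exact Set.eq_univ_of_forall fun t => ⟨t.2.1, t.2.2⟩
  have := hm.eVariationOn_eq (a := 0) (b := 1) (Set.mem_univ _) (Set.mem_univ _)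
  rw [hI] at this
  exact this.trans_lt ENNReal.ofReal_lt_top

theorem NoRectifiableCurves.noGeodesics {ω : Ultrafilter ℕ} {X : Type u} [MetricSpace X]
    (h : NoRectifiableCurves ω X) : NoGeodesics ω X := by
  rintro r x ⟨γ, hγ, hn⟩
  exact h r x ⟨γ, hγ.isRectifiable, hn⟩

/-! ### Approximate progressions and line-fitting. -/

/-- `X` contains, up to rescaling, arbitrarily precise copies of the arithmetic progressions
`0, 1 / N, …, 1`. -/
def HasApproxProgressions (X : Type u) [MetricSpace X] : Prop :=
  ∀ N : ℕ, 1 ≤ N → ∀ δ : ℝ, 0 < δ → ∃ c : ℝ, 0 < c ∧ ∃ x : ℕ → X, ∀ i ≤ N, ∀ j ≤ N,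
    |c * dist (x i) (x j) - |(i : ℝ) - j| / N| ≤ δ

theorem LineFitting.hasApproxProgressions {X : Type u} [MetricSpace X] (h : LineFitting X) :
    HasApproxProgressions X := by
  intro N hN δ hδ
  -- Each of the two endpoints is moved by less than `δ / 2` when `[0, 1]` is replaced by nearby
  -- points of `X`.
  obtain ⟨m, hm⟩ := exists_nat_one_div_lt (half_pos hδ)
  obtain ⟨D, hI, ⟨c, hc, hX⟩, hn⟩ := h (m + 1) (by omega)
  choose g hg using hn
  have hN0 : (0 : ℝ) < N := by exact_mod_cast hN
  let q : ℕ → unitInterval := fun i => Set.projIcc 0 1 zero_le_one ((i : ℝ) / N)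
  have hq : ∀ i ≤ N, (q i : ℝ) = i / N := fun i hi => by
    have : (i : ℝ) / N ∈ Set.Icc (0 : ℝ) 1 :=
      ⟨by positivity, (div_le_one hN0).2 (by exact_mod_cast hi)⟩
    simp only [q, Set.projIcc_of_mem zero_le_one this]
  refine ⟨c, hc, fun i => g (q i), fun i hi j hj => ?_⟩
  rw [← hX]
  have e : |(i : ℝ) - j| / N = D.dist (Sum.inr (q i)) (Sum.inr (q j)) := by
    rw [hI, hq i hi, hq j hj, ← sub_div, abs_div, abs_of_pos hN0]
  rw [e]
  have hi' := hg (q i)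
  have hj' := hg (q j)
  push_cast at hi' hj'
  have t1 := D.dist_triangle (Sum.inl (g (q i))) (Sum.inr (q i)) (Sum.inl (g (q j)))
  have t2 := D.dist_triangle (Sum.inr (q i)) (Sum.inr (q j)) (Sum.inl (g (q j)))
  have t3 := D.dist_triangle (Sum.inr (q i)) (Sum.inl (g (q i))) (Sum.inr (q j))
  have t4 := D.dist_triangle (Sum.inl (g (q i))) (Sum.inl (g (q j))) (Sum.inr (q j))
  rw [D.dist_comm (Sum.inl (g (q i))) (Sum.inr (q i))] at t1
  rw [D.dist_comm (Sum.inl (g (q j))) (Sum.inr (q j))] at t4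
  rw [abs_le]
  constructor <;> linarith

theorem exists_nat_abs_sub_div_le {N : ℕ} (hN : 1 ≤ N) (t : unitInterval) :
    ⌊(t : ℝ) * N⌋₊ ≤ N ∧ |(t : ℝ) - ⌊(t : ℝ) * N⌋₊ / N| ≤ 1 / N := by
  have hN0 : (0 : ℝ) < N := by exact_mod_cast hN
  have h0 : 0 ≤ (t : ℝ) * N := mul_nonneg t.2.1 hN0.le
  have h1 := Nat.floor_le h0
  have h2 := Nat.lt_floor_add_one ((t : ℝ) * N)
  constructor
  · have : (⌊(t : ℝ) * N⌋₊ : ℝ) ≤ N := h1.trans (mul_le_of_le_one_left hN0.le t.2.2)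
    exact_mod_cast this
  · have : (t : ℝ) - ⌊(t : ℝ) * N⌋₊ / N = (t * N - ⌊(t : ℝ) * N⌋₊) / N := by field_simp
    rw [this, abs_of_nonneg (div_nonneg (by linarith) hN0.le)]
    gcongr
    linarith

/-- Rescaled `X` and `[0, 1]` are glued along a progression with `2n` steps. A distortion of `1 /
(2n)` allows a gluing gap of `1 / (4n)`; each `t` is within `1 / (2n)` of a sample, and `1 / (2n) +
1 / (4n) < 1 / n`. -/
theorem HasApproxProgressions.lineFitting {X : Type u} [MetricSpace X]
    (h : HasApproxProgressions X) : LineFitting X := by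
  intro n hn
  have hn0 : (0 : ℝ) < n := by exact_mod_cast hn
  obtain ⟨c, hc, x, hx⟩ := h (2 * n) (by omega) (1 / (2 * n)) (by positivity)
  have hN0 : (0 : ℝ) < ((2 * n : ℕ) : ℝ) := by push_cast; positivity
  let Φ : Fin (2 * n + 1) → Rescaled X ⟨c, hc⟩ := fun p => ⟨x p⟩
  let Ψ : Fin (2 * n + 1) → unitInterval := fun p =>
    ⟨(p : ℕ) / (2 * n : ℕ), by positivity,
      (div_le_one hN0).2 (by exact_mod_cast Nat.lt_succ_iff.1 p.2)⟩
  have H : ∀ p q, |dist (Φ p) (Φ q) - dist (Ψ p) (Ψ q)| ≤ 2 * (1 / (4 * n : ℝ)) := by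
    intro p q
    have := hx p (Nat.lt_succ_iff.1 p.2) q (Nat.lt_succ_iff.1 q.2)
    have e1 : dist (Φ p) (Φ q) = c * dist (x p) (x q) := rfl
    have e2 : dist (Ψ p) (Ψ q) = |((p : ℕ) : ℝ) - (q : ℕ)| / (2 * n : ℕ) := by
      rw [Subtype.dist_eq, Real.dist_eq, ← sub_div, abs_div, abs_of_pos hN0]
    rw [e1, e2]
    refine this.trans_eq ?_
    field_simp
    norm_num
  let M : MetricSpace (Rescaled X ⟨c, hc⟩ ⊕ unitInterval) :=
    Metric.glueMetricApprox Φ Ψ (1 / (4 * n : ℝ)) (by positivity) H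
  have hinj : Function.Injective
      (Sum.map (Rescaled.mk : X → Rescaled X ⟨c, hc⟩) (id : unitInterval → unitInterval)) :=
    Function.Injective.sumMap (fun a b hab => congrArg Rescaled.val hab) Function.injective_id
  refine ⟨MetricSpace.induced _ hinj M, fun s t => rfl, ⟨c, hc, fun y z => rfl⟩, fun t => ?_⟩
  obtain ⟨hi, ht⟩ := exists_nat_abs_sub_div_le (N := 2 * n) (by omega) t
  set i := ⌊(t : ℝ) * (2 * n : ℕ)⌋₊
  refine ⟨x i, ?_⟩
  let p : Fin (2 * n + 1) := ⟨i, Nat.lt_succ_iff.2 hi⟩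
  have hle : (⨅ q, dist (Φ p) (Φ q) + dist t (Ψ q)) ≤ dist (Φ p) (Φ p) + dist t (Ψ p) :=
    ciInf_le (Set.finite_range _).bddBelow p
  have he : dist t (Ψ p) = |(t : ℝ) - i / (2 * n : ℕ)| := rfl
  rw [dist_self, zero_add, he] at hle
  have hlt : (⨅ q, dist (Φ p) (Φ q) + dist t (Ψ q)) + 1 / (4 * n : ℝ) < 1 / n := by
    have h1 : 1 / ((2 * n : ℕ) : ℝ) + 1 / (4 * n : ℝ) < 1 / n := by
      push_cast
      rw [div_add_div _ _ (by positivity) (by positivity), div_lt_div_iff₀ (by positivity) hn0]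
      nlinarith [mul_pos hn0 hn0, mul_pos (mul_pos hn0 hn0) hn0]
    linarith
  exact hlt

theorem lineFitting_iff {X : Type u} [MetricSpace X] :
    LineFitting X ↔ HasApproxProgressions X :=
  ⟨LineFitting.hasApproxProgressions, HasApproxProgressions.lineFitting⟩

/-! ### From approximate progressions to geodesics in ultralimits. -/

theorem IsNonprincipal.le_atTop {ω : Ultrafilter ℕ} (hω : IsNonprincipal ω) :
    (ω : Filter ℕ) ≤ atTop := by
  rw [← Nat.cofinite_eq_atTop]
  intro s hs
  have := hω _ (mem_cofinite.1 hs)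
  rwa [Ultrafilter.compl_mem_iff_notMem, not_not] at this

theorem HasApproxProgressions.not_noGeodesics {X : Type u} [MetricSpace X]
    (h : HasApproxProgressions X) {ω : Ultrafilter ℕ} (hω : IsNonprincipal ω) :
    ¬ NoGeodesics ω X := by
  have h' := fun n : ℕ => h (n + 1) (by omega) (1 / ((n : ℝ) + 1)) (by positivity)
  choose c hc x hx using h'
  intro hng
  let r : ℕ → Set.Ioi (0 : ℝ) := fun n => ⟨c n, hc n⟩
  -- At stage `n`, time `t` is sent to the progression point just before it; in the limit this
  -- embeds `[0, 1]` isometrically.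
  let y : unitInterval → ∀ n, Rescaled X (r n) := fun t n => ⟨x n ⌊(t : ℝ) * (n + 1 : ℕ)⌋₊⟩
  have hlim : ∀ t s : unitInterval,
      Tendsto (fun n => dist (y t n) (y s n)) ω (𝓝 |(t : ℝ) - s|) := by
    intro t s
    refine Tendsto.mono_left ?_ hω.le_atTop
    -- One error `1 / (n + 1)` comes from the progression and one from each of the two roundings.
    have hz : Tendsto (fun n : ℕ => 3 * (1 / ((n : ℝ) + 1))) atTop (𝓝 0) := by
      simpa using tendsto_one_div_add_atTop_nhds_zero_nat.const_mul (3 : ℝ)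
    refine tendsto_iff_dist_tendsto_zero.2 (squeeze_zero (fun _ => dist_nonneg) (fun n => ?_) hz)
    obtain ⟨ht, ht'⟩ := exists_nat_abs_sub_div_le (N := n + 1) (by omega) t
    obtain ⟨hs, hs'⟩ := exists_nat_abs_sub_div_le (N := n + 1) (by omega) s
    have hxn := hx n _ ht _ hs
    have e : dist (y t n) (y s n) =
      c n * dist (x n ⌊(t : ℝ) * (n + 1 : ℕ)⌋₊) (x n ⌊(s : ℝ) * (n + 1 : ℕ)⌋₊) := rfl
    rw [e, Real.dist_eq]
    generalize ⌊(t : ℝ) * (n + 1 : ℕ)⌋₊ = i at *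
    generalize ⌊(s : ℝ) * (n + 1 : ℕ)⌋₊ = j at *
    have hN0 : (0 : ℝ) < ((n + 1 : ℕ) : ℝ) := by positivity
    have e2 : |(i : ℝ) - j| / (n + 1 : ℕ) = |(i : ℝ) / (n + 1 : ℕ) - j / (n + 1 : ℕ)| := by
      rw [← sub_div, abs_div, abs_of_pos hN0]
    rw [e2] at hxn
    generalize (i : ℝ) / (n + 1 : ℕ) = a at *
    generalize (j : ℝ) / (n + 1 : ℕ) = b at *
    push_cast at ht' hs'
    generalize 1 / ((n : ℝ) + 1) = δ at *
    have h3 : abs (|a - b| - |(t : ℝ) - s|) ≤ |(t : ℝ) - a| + |(s : ℝ) - b| := by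
      refine (abs_abs_sub_abs_le_abs_sub _ _).trans ?_
      have : a - b - (t - s) = -((t : ℝ) - a) + (s - b) := by ring
      rw [this]
      exact (abs_add_le _ _).trans_eq (by rw [abs_neg])
    refine (abs_sub_le _ |a - b| _).trans ?_
    linarith
  have hbase : ∀ n, y 0 n = ⟨x n 0⟩ := fun n => by simp [y]
  have hadm : ∀ t, IsAdmissible ω (fun n => (⟨x n 0⟩ : Rescaled X (r n))) (y t) := fun t =>
    ⟨_, by simpa only [hbase] using hlim 0 t⟩
  let g : unitInterval → OmegaLimit ω X r fun n => x n 0 := fun t =>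
    SeparationQuotient.mk ⟨y t, hadm t⟩
  have hg : ∀ t s, dist (g t) (g s) = |(t : ℝ) - s| := fun t s =>
    tendsto_nhds_unique (Ultralimit.tendsto_dist _ _) (hlim t s)
  have hgi : Isometry g := Isometry.of_dist_eq fun t s => hg t s
  refine hng r (fun n => x n 0) ⟨⟨g, hgi.continuous⟩, fun t s => ?_, 0, 1, fun h01 => ?_⟩
  · simp [hg]
  · exact zero_ne_one (hgi.injective h01)

/-! ### Approximate progressions and the SRA conditions. -/

theorem SatisfiesSomeSRA.not_hasApproxProgressions {X : Type u} [MetricSpace X]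
    (h : SatisfiesSomeSRA X) : ¬ HasApproxProgressions X := by
  obtain ⟨k, ε, α, hk, hε, hα, h⟩ := h
  intro hap
  obtain ⟨N, rfl⟩ : ∃ N, k = N + 1 := ⟨k - 1, by omega⟩
  have hN : 1 ≤ N := by omega
  have hN0 : (0 : ℝ) < N := by exact_mod_cast hN
  -- The first bound gives `1 / N + δ ≤ (1 + ε) * (1 / N - δ)`, so the steps are admissible for SRA.
  -- The second gives `1 + N * δ < (1 + α) * (1 - δ)`, contradicting its conclusion; the factor `2`
  -- makes this strict.
  set δ : ℝ := min (ε / (N * (2 + ε))) (α / (2 * (N + 1 + α)))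
  have hδ : 0 < δ := by positivity
  have hδ1 : δ * (N * (2 + ε)) ≤ ε := (le_div_iff₀ (by positivity)).1 (min_le_left _ _)
  have hδ2 : δ * (2 * (N + 1 + α)) ≤ α := (le_div_iff₀ (by positivity)).1 (min_le_right _ _)
  obtain ⟨c, hc, x, hx⟩ := hap N hN δ hδ
  have hstep : ∀ i ∈ Finset.Ico 1 (N + 1),
      |c * dist (x (i - 1)) (x (i + 1 - 1)) - 1 / N| ≤ δ := by
    intro i hi
    rw [Finset.mem_Ico] at hi
    have := hx (i - 1) (by omega) (i + 1 - 1) (by omega)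
    have e : |((i - 1 : ℕ) : ℝ) - ((i + 1 - 1 : ℕ) : ℝ)| = 1 := by
      rw [Nat.cast_sub hi.1, Nat.add_sub_cancel]
      push_cast
      rw [sub_right_comm, sub_self, zero_sub, abs_neg, abs_one]
    rwa [e] at this
  have hsra := h (fun i => x (i - 1)) (by
    intro i hi j hj
    have h1 := (abs_le.1 (hstep i hi)).2
    have h2 := (abs_le.1 (hstep j hj)).1
    refine le_of_mul_le_mul_left ?_ hc
    have h3 : 1 / N + δ ≤ (1 + ε) * (1 / N - δ) := by
      have : 1 / N * (δ * (N * (2 + ε))) ≤ 1 / N * ε := by gcongr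
      have e : 1 / N * (δ * (N * (2 + ε))) = δ * (2 + ε) := by field_simp
      rw [e] at this
      linarith
    have h4 : (1 + ε) * (1 / N - δ) ≤ (1 + ε) * (c * dist (x (j - 1)) (x (j + 1 - 1))) := by
      gcongr
      linarith
    linarith)
  have hsum : c * ∑ i ∈ Finset.Ico 1 (N + 1), dist (x (i - 1)) (x (i + 1 - 1)) ≤
      N * (1 / N + δ) := by
    rw [Finset.mul_sum]
    refine (Finset.sum_le_card_nsmul _ _ (1 / N + δ) fun i hi => ?_).trans_eq (by
      rw [Nat.card_Ico, Nat.add_sub_cancel, nsmul_eq_mul])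
    linarith [(abs_le.1 (hstep i hi)).2]
  have hends := hx 0 (by omega) N le_rfl
  have e : |((0 : ℕ) : ℝ) - (N : ℝ)| / N = 1 := by
    rw [Nat.cast_zero, zero_sub, abs_neg, abs_of_pos hN0, div_self hN0.ne']
  rw [e] at hends
  have h5 := (abs_le.1 hends).1
  have h6 : (1 + α) * (c * dist (x 0) (x N)) ≤ N * (1 / N + δ) := by
    refine le_trans ?_ hsum
    rw [mul_left_comm]
    exact mul_le_mul_of_nonneg_left hsra hc.le
  have h7 : (1 + α) * (1 - δ) ≤ (1 + α) * (c * dist (x 0) (x N)) := by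
    gcongr
    linarith
  have e2 : N * (1 / N + δ) = 1 + N * δ := by field_simp
  rw [e2] at h6
  linarith

/-- A chain violating SRA has nearly equal steps and almost no excess over the distance of its ends.
No subchain can then have much excess either, so the chain is nearly a progression. -/
theorem satisfiesSomeSRA_of_not_hasApproxProgressions {X : Type u} [MetricSpace X]
    (h : ¬ HasApproxProgressions X) : SatisfiesSomeSRA X := by
  by_contra hsra
  refine h fun N hN δ hδ => ?_
  have hN0 : (0 : ℝ) < N := by exact_mod_cast hN
  -- After division by `N * m` the error is at most `2 * ε`: one `ε` from the unequal steps, one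
  -- from the excess, where `ε ≤ 1` gives `d(y 0, y N) ≤ 2 * N * m`.
  set ε : ℝ := min (δ / 2) 1
  have hε : 0 < ε := by positivity
  have hε1 : ε ≤ 1 := min_le_right _ _
  have hεδ : 2 * ε ≤ δ := by linarith [min_le_left (δ / 2) 1]
  have hno : ¬ SRA X (N + 1) ε (ε / 2) := fun hs =>
    hsra ⟨N + 1, ε, ε / 2, by omega, hε, half_pos hε, hs⟩
  unfold SRA at hno
  push Not at hno
  obtain ⟨z, hz, hlt⟩ := hno
  set y : ℕ → X := fun i => z (i + 1)
  set m := dist (y 0) (y 1)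
  have hup : ∀ i < N, dist (y i) (y (i + 1)) ≤ (1 + ε) * m := fun i hi =>
    hz (i + 1) (by simp; omega) 1 (by simp; omega)
  have hlow : ∀ i < N, m * (1 - ε) ≤ dist (y i) (y (i + 1)) := fun i hi => by
    have h1 : m ≤ (1 + ε) * dist (y i) (y (i + 1)) :=
      hz 1 (by simp; omega) (i + 1) (by simp; omega)
    nlinarith [dist_nonneg (x := y i) (y := y (i + 1)),
      mul_nonneg (mul_nonneg hε.le hε.le) (dist_nonneg (x := y i) (y := y (i + 1)))]
  have hS : ∀ i j, i ≤ j → j ≤ N →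
      (∑ l ∈ Finset.Ico i j, dist (y l) (y (l + 1)) ≤ (j - i) * ((1 + ε) * m)) ∧
      (j - i) * (m * (1 - ε)) ≤ ∑ l ∈ Finset.Ico i j, dist (y l) (y (l + 1)) := by
    intro i j hij hj
    have hc : ((Finset.Ico i j).card : ℝ) = j - i := by
      rw [Nat.card_Ico, Nat.cast_sub hij]
    constructor
    · rw [← hc, ← nsmul_eq_mul]
      exact Finset.sum_le_card_nsmul _ _ _ fun l hl => hup l (by rw [Finset.mem_Ico] at hl; omega)
    · rw [← hc, ← nsmul_eq_mul]
      exact Finset.card_nsmul_le_sum _ _ _ fun l hl => hlow l (by rw [Finset.mem_Ico] at hl; omega)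
  have htot : ∑ l ∈ Finset.Ico 0 N, dist (y l) (y (l + 1)) < (1 + ε / 2) * dist (y 0) (y N) := by
    have e : ∑ i ∈ Finset.Ico 1 (N + 1), dist (z i) (z (i + 1)) =
        ∑ l ∈ Finset.Ico 0 N, dist (y l) (y (l + 1)) := by
      rw [← Finset.sum_Ico_add' (fun i => dist (z i) (z (i + 1))) 0 N 1]
    rw [e] at hlt
    exact hlt
  have hD : dist (y 0) (y N) ≤ ∑ l ∈ Finset.Ico 0 N, dist (y l) (y (l + 1)) :=
    dist_le_Ico_sum_dist y (Nat.zero_le N)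
  have hT := (hS 0 N (Nat.zero_le N) le_rfl).1
  rw [Nat.cast_zero, sub_zero] at hT
  have hm : 0 < m := by
    rcases (dist_nonneg : 0 ≤ m).eq_or_lt with h0 | h0
    · have h0' : m = 0 := h0.symm
      rw [h0', mul_zero, mul_zero] at hT
      have : 0 ≤ dist (y 0) (y N) := dist_nonneg
      nlinarith
    · exact h0
  have key : ∀ i j, i ≤ j → j ≤ N →
      |((N : ℝ) * m)⁻¹ * dist (y i) (y j) - |(i : ℝ) - j| / N| ≤ δ := by
    intro i j hij hj
    have hij' : (i : ℝ) ≤ j := by exact_mod_cast hij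
    have hjN : (j : ℝ) - i ≤ N := by
      have : (j : ℝ) ≤ N := by exact_mod_cast hj
      have : (0 : ℝ) ≤ i := by positivity
      linarith
    have h1 := hS i j hij hj
    have h2 : dist (y i) (y j) ≤ ∑ l ∈ Finset.Ico i j, dist (y l) (y (l + 1)) :=
      dist_le_Ico_sum_dist y hij
    have h3 : dist (y 0) (y i) ≤ ∑ l ∈ Finset.Ico 0 i, dist (y l) (y (l + 1)) :=
      dist_le_Ico_sum_dist y (Nat.zero_le i)
    have h4 : dist (y j) (y N) ≤ ∑ l ∈ Finset.Ico j N, dist (y l) (y (l + 1)) :=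
      dist_le_Ico_sum_dist y hj
    have h5 := Finset.sum_Ico_consecutive (fun l => dist (y l) (y (l + 1))) (Nat.zero_le i) hij
    have h6 := Finset.sum_Ico_consecutive (fun l => dist (y l) (y (l + 1))) (Nat.zero_le j) hj
    have h7 := dist_triangle4 (y 0) (y i) (y j) (y N)
    have h8 : ε / 2 * dist (y 0) (y N) ≤ ε / 2 * (N * (2 * m)) := by
      have : N * ((1 + ε) * m) ≤ N * (2 * m) := by gcongr; linarith
      gcongr
      linarith
    have h9 : (j - i : ℝ) * (m * ε) ≤ N * (m * ε) := by gcongr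
    have h10 : |N * m * (((N : ℝ) * m)⁻¹ * dist (y i) (y j) - |(i : ℝ) - j| / N)| ≤
        N * m * δ := by
      have e : N * m * (((N : ℝ) * m)⁻¹ * dist (y i) (y j) - |(i : ℝ) - j| / N) =
          dist (y i) (y j) - (j - i) * m := by
        rw [abs_of_nonpos (by linarith)]
        field_simp
        ring
      have h11 : N * m * (2 * ε) ≤ N * m * δ := by gcongr
      have h12 : 0 ≤ N * (m * ε) := by positivity
      rw [e, abs_le]
      constructor <;> linarith
    rw [abs_mul, abs_of_pos (by positivity : 0 < N * m)] at h10
    exact le_of_mul_le_mul_left h10 (by positivity)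
  refine ⟨((N : ℝ) * m)⁻¹, by positivity, y, fun i hi j hj => ?_⟩
  rcases le_total i j with hij | hij
  · exact key i j hij hj
  · rw [dist_comm, abs_sub_comm (i : ℝ)]
    exact key j i hij hi

theorem satisfiesSomeSRA_iff {X : Type u} [MetricSpace X] :
    SatisfiesSomeSRA X ↔ ¬ HasApproxProgressions X :=
  ⟨SatisfiesSomeSRA.not_hasApproxProgressions, satisfiesSomeSRA_of_not_hasApproxProgressions⟩

/-! ### Fine paths, and the chain inequality from the absence of progressions. -/

/-- `FinePath δ x y ℓ` says that there is a finite chain from `x` to `y`, of total length `ℓ`, whose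
consecutive points are at distance at most `δ`. -/
inductive FinePath {X : Type u} [MetricSpace X] (δ : ℝ) : X → X → ℝ → Prop
  | nil (x : X) : FinePath δ x x 0
  | cons {x y z : X} {ℓ : ℝ} (h : dist x y ≤ δ) (p : FinePath δ y z ℓ) :
      FinePath δ x z (dist x y + ℓ)

/-- A fine path can be parametrized by arc length, up to an error given by its mesh. -/
theorem FinePath.exists_parametrization {X : Type u} [MetricSpace X] {δ ℓ : ℝ} {x y : X}
    (hδ : 0 ≤ δ) (h : FinePath δ x y ℓ) :
    0 ≤ ℓ ∧ ∃ g : ℝ → X, g 0 = x ∧ g ℓ = y ∧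
      (∀ t, 0 ≤ t → dist (g 0) (g t) ≤ t) ∧
      ∀ s t, 0 ≤ s → s ≤ t → dist (g s) (g t) ≤ t - s + δ := by
  induction h with
  | nil x =>
    refine ⟨le_rfl, fun _ => x, rfl, rfl, fun t ht => by simpa using ht, fun s t _ hst => ?_⟩
    rw [dist_self]
    linarith
  | @cons x y z ℓ h _ ih =>
    obtain ⟨hℓ, g, h0, h1, hg0, hg⟩ := ih
    have hd : 0 ≤ dist x y := dist_nonneg
    -- The parametrization waits at `x` for time `dist x y`, then follows the rest. Bounding
    -- distances from the start without the error `δ` keeps errors from accumulating.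
    refine ⟨by positivity, fun t => if t < dist x y then x else g (t - dist x y), ?_, ?_, ?_⟩
    · dsimp only
      split_ifs with h2
      · rfl
      · have h3 : dist x y = 0 := le_antisymm (not_lt.1 h2) hd
        rw [h3, sub_zero, h0, dist_eq_zero.1 h3]
    · have : ¬ dist x y + ℓ < dist x y := by linarith
      simp [this, h1]
    have hx : ∀ t, 0 ≤ t →
        dist x (if t < dist x y then x else g (t - dist x y)) ≤ t := by
      intro t ht
      split_ifs with h2
      · simpa using ht
      · have := hg0 (t - dist x y) (by linarith)
        rw [h0] at this
        linarith [dist_triangle x y (g (t - dist x y))]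
    have hz : (if 0 < dist x y then x else g (0 - dist x y)) = x :=
      dist_le_zero.1 (dist_comm x _ ▸ hx 0 le_rfl)
    refine ⟨fun t ht => ?_, fun s t hs hst => ?_⟩
    · dsimp only
      rw [hz]
      exact hx t ht
    · dsimp only
      by_cases h2 : s < dist x y
      · rw [if_pos h2]
        -- Here `s < dist x y ≤ δ`, so `t ≤ t - s + δ`.
        linarith [hx t (hs.trans hst)]
      · rw [if_neg h2, if_neg (by linarith)]
        linarith [hg (s - dist x y) (t - dist x y) (by linarith) (by linarith)]

/-- In the absence of approximate arithmetic progressions, fine paths are longer than the distance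
of their endpoints by a definite factor. -/
theorem exists_finePath_length_ge {X : Type u} [MetricSpace X] (h : ¬ HasApproxProgressions X) :
    ∃ η : ℝ, 0 < η ∧ η < 1 ∧ ∀ (x y : X) (ℓ : ℝ), FinePath (η * dist x y) x y ℓ →
      (1 + η) * dist x y ≤ ℓ := by
  by_contra! hcon
  refine h fun N hN δ hδ => ?_
  have hN0 : (0 : ℝ) < N := by exact_mod_cast hN
  -- Sampling a short fine path at equal times costs at most `2 * η * D`, from the mesh and from the
  -- excess `ℓ - D < η * D`; this is at most `δ * ℓ` as `D ≤ ℓ`.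
  set η : ℝ := min (δ / 2) (1 / 2)
  have hη : 0 < η := by positivity
  have hη1 : η < 1 := lt_of_le_of_lt (min_le_right _ _) (by norm_num)
  have hηδ : 2 * η ≤ δ := by linarith [min_le_left (δ / 2) (1 / 2)]
  obtain ⟨x, y, ℓ, hp, hlt⟩ := hcon η hη hη1
  obtain ⟨hℓ0, g, h0, h1, hg0, hg⟩ := hp.exists_parametrization (by positivity)
  set D := dist x y
  have hDℓ : D ≤ ℓ := by
    have := hg0 ℓ hℓ0
    rwa [h0, h1] at this
  have hD : 0 < D := by
    rcases (dist_nonneg : 0 ≤ D).eq_or_lt with h2 | h2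
    · have h2' : D = 0 := h2.symm
      rw [h2', mul_zero] at hlt
      linarith
    · exact h2
  have hℓ : 0 < ℓ := hD.trans_le hDℓ
  have key : ∀ i j : ℕ, i ≤ j → j ≤ N →
      |ℓ⁻¹ * dist (g (i * ℓ / N)) (g (j * ℓ / N)) - |(i : ℝ) - j| / N| ≤ δ := by
    intro i j hij hj
    have hij' : (i : ℝ) ≤ j := by exact_mod_cast hij
    have hj' : (j : ℝ) ≤ N := by exact_mod_cast hj
    have e : |(i : ℝ) - j| / N = ℓ⁻¹ * (j * ℓ / N - i * ℓ / N) := by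
      rw [abs_of_nonpos (by linarith)]
      field_simp
      ring
    have hs : 0 ≤ i * ℓ / N := by positivity
    have hst : i * ℓ / N ≤ j * ℓ / N := by gcongr
    have ht : j * ℓ / N ≤ ℓ := by
      rw [div_le_iff₀ hN0, mul_comm]
      gcongr
    rw [e, ← mul_sub, abs_mul, abs_of_pos (inv_pos.2 hℓ), inv_mul_le_iff₀ hℓ]
    generalize i * ℓ / N = s at *
    generalize j * ℓ / N = t at *
    have h2 := hg s t hs hst
    have h3 := hg0 s hs
    have h4 := hg t ℓ (hs.trans hst) ht
    have h5 := dist_triangle4 (g 0) (g s) (g t) (g ℓ)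
    have h6 : dist (g 0) (g ℓ) = D := by rw [h0, h1]
    have h7 : 2 * η * D ≤ δ * ℓ := by gcongr
    have h8 : 0 ≤ η * D := by positivity
    rw [mul_comm ℓ δ, abs_le]
    constructor <;> linarith
  refine ⟨ℓ⁻¹, by positivity, fun i => g (i * ℓ / N), fun i hi j hj => ?_⟩
  rcases le_total i j with hij | hij
  · exact key i j hij hj
  · rw [dist_comm, abs_sub_comm (i : ℝ)]
    exact key j i hij hi

/-- Greedy coarsening: a chain with steps at most `h` is replaced by a path whose steps, except for
the last one, have length between `h` and `2 * h`. -/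
theorem exists_finePath_of_chain {X : Type u} [MetricSpace X] {x : ℕ → X} {b : ℕ} {h p K : ℝ}
    (hh : 0 < h) (hp : 1 < p) (hK : 0 ≤ K)
    (hstep : ∀ i < b, dist (x i) (x (i + 1)) ≤ h)
    (hsub : ∀ i j, i < j → j ≤ b → dist (x i) (x j) ≤ 2 * h →
      dist (x i) (x j) ^ p ≤ K * ∑ l ∈ Finset.Ico i j, dist (x l) (x (l + 1)) ^ p)
    (n : ℕ) : ∀ i, i + n = b → ∃ ℓ, FinePath (2 * h) (x i) (x b) ℓ ∧
      h ^ (p - 1) * ℓ ≤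
        h ^ (p - 1) * h + K * ∑ l ∈ Finset.Ico i b, dist (x l) (x (l + 1)) ^ p := by
  have hhp : 0 < h ^ (p - 1) := Real.rpow_pos_of_pos hh _
  induction n using Nat.strong_induction_on with
  | _ n ih =>
  intro i hi
  by_cases hex : ∃ j, i < j ∧ j ≤ b ∧ h ≤ dist (x i) (x j)
  · classical
    obtain ⟨hij, hjb, hj⟩ := Nat.find_spec hex
    have hmin := fun k hk => Nat.find_min hex (m := k) hk
    set j := Nat.find hex
    -- As `j` is the first index at distance at least `h` from `x i`, and a step adds at most `h`,
    -- the new step lies between `h` and `2 * h`.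
    have hprev : dist (x i) (x (j - 1)) < h := by
      rcases eq_or_lt_of_le (Nat.le_sub_one_of_lt hij) with h1 | h1
      · rwa [← h1, dist_self]
      · have := hmin (j - 1) (by omega)
        push Not at this
        exact this h1 (by omega)
    have hlast := hstep (j - 1) (by omega)
    rw [Nat.sub_add_cancel (by omega)] at hlast
    have hd : dist (x i) (x j) ≤ 2 * h := by
      linarith [dist_triangle (x i) (x (j - 1)) (x j)]
    obtain ⟨ℓ, hpath, hℓ⟩ := ih (b - j) (by omega) j (by omega)
    refine ⟨_, FinePath.cons hd hpath, ?_⟩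
    have h2 : h ^ (p - 1) * dist (x i) (x j) ≤ dist (x i) (x j) ^ p := by
      have : dist (x i) (x j) ^ p = dist (x i) (x j) ^ (p - 1) * dist (x i) (x j) := by
        rw [← Real.rpow_add_one' dist_nonneg (by linarith), sub_add_cancel]
      rw [this]
      exact mul_le_mul_of_nonneg_right (Real.rpow_le_rpow hh.le hj (by linarith)) dist_nonneg
    have h3 := hsub i j hij hjb hd
    rw [← Finset.sum_Ico_consecutive _ hij.le hjb, mul_add, mul_add]
    linarith
  · push Not at hex
    have hib : dist (x i) (x b) ≤ h := by
      rcases eq_or_lt_of_le (show i ≤ b by omega) with h1 | h1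
      · rw [h1, dist_self]
        exact hh.le
      · exact (hex b h1 le_rfl).le
    -- The leftover step may be too short to be charged to the sum; it accounts for the additive
    -- term `h ^ (p - 1) * h`.
    refine ⟨_, FinePath.cons (by linarith) (FinePath.nil _), ?_⟩
    have : 0 ≤ K * ∑ l ∈ Finset.Ico i b, dist (x l) (x (l + 1)) ^ p := by positivity
    rw [add_zero]
    have := mul_le_mul_of_nonneg_left hib hhp.le
    linarith

/-- As `p` decreases to `1`, `(η / 2) ^ (p - 1)` tends to `1`, so the factor `1 + η / 2` wins. -/
theorem exists_rpow_sub_one_ge {η : ℝ} (hη : 0 < η) :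
    ∃ p : ℝ, 1 < p ∧ 1 ≤ (1 + η / 2) * (η / 2) ^ (p - 1) := by
  have hlim : Tendsto (fun q : ℝ => (1 + η / 2) * (η / 2) ^ q) (𝓝[>] 0) (𝓝 (1 + η / 2)) := by
    have := (Real.continuousAt_const_rpow (a := η / 2) (b := 0) (by positivity)).tendsto
    rw [Real.rpow_zero] at this
    simpa using (this.const_mul (1 + η / 2)).mono_left nhdsWithin_le_nhds
  obtain ⟨q, hq, hq0⟩ := ((hlim.eventually (lt_mem_nhds (by linarith : (1 : ℝ) < 1 + η / 2))).and
    self_mem_nhdsWithin).exists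
  exact ⟨1 + q, by simpa using hq0, by simpa using hq.le⟩

theorem satisfiesChainInequality_of_not_hasApproxProgressions {X : Type u} [MetricSpace X]
    (h : ¬ HasApproxProgressions X) : SatisfiesChainInequality X := by
  obtain ⟨η, hη, hη1, hpath⟩ := exists_finePath_length_ge h
  obtain ⟨p, hp, hηp⟩ := exists_rpow_sub_one_ge hη
  have hp0 : 0 < p := by linarith
  -- With this `K`, a single step longer than `s = η / 2 * D` already proves the inequality.
  set K : ℝ := ((η / 2) ^ p)⁻¹
  have hK : 0 < K := by positivity
  refine ⟨p, K, hp, hK, fun x m => ?_⟩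
  induction m using Nat.strong_induction_on generalizing x with
  | _ m ih =>
  set D := dist (x 0) (x m)
  have hsum0 : 0 ≤ ∑ i ∈ Finset.range m, dist (x i) (x (i + 1)) ^ p := by positivity
  rcases (dist_nonneg : 0 ≤ D).eq_or_lt with hD | hD
  · have hD' : D = 0 := hD.symm
    rw [hD', Real.zero_rpow hp0.ne']
    positivity
  set s : ℝ := η / 2 * D
  have hs : 0 < s := by positivity
  have hsD : 2 * s < D := by
    have : η * D < 1 * D := by gcongr
    simp only [s]
    linarith
  by_cases hbig : ∃ i < m, s < dist (x i) (x (i + 1))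
  · obtain ⟨i, hi, hsi⟩ := hbig
    have h1 : s ^ p ≤ ∑ i ∈ Finset.range m, dist (x i) (x (i + 1)) ^ p :=
      (Real.rpow_le_rpow hs.le hsi.le hp0.le).trans
        (Finset.single_le_sum (f := fun i => dist (x i) (x (i + 1)) ^ p)
          (fun _ _ => by positivity) (Finset.mem_range.2 hi))
    calc D ^ p = K * s ^ p := by
          rw [Real.mul_rpow (by positivity) hD.le, inv_mul_cancel_left₀ (by positivity)]
      _ ≤ _ := by gcongr
  · push Not at hbig
    -- Coarsening at scale `s` gives mesh `2 * s = η * D`, hence length at least `(1 + η) * D`;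
    -- giving up the leftover `s` leaves `(1 + η / 2) * D`.
    obtain ⟨ℓ, hℓ, hle⟩ := exists_finePath_of_chain hs hp hK.le hbig (fun i j hij hjm hd => by
      -- Only blocks with ends at distance at most `2 * s < D` occur, never the whole chain, so the
      -- induction hypothesis applies.
      have hlt : j - i < m := by
        by_contra hcon
        obtain rfl : i = 0 := by omega
        obtain rfl : j = m := by omega
        exact absurd hd (not_le.2 hsD)
      have := ih (j - i) hlt (fun l => x (i + l))
      rw [Finset.sum_Ico_eq_sum_range]
      simpa only [add_zero, Nat.add_sub_cancel' hij.le, add_assoc] using this) m 0 (zero_add m)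
    have e2 : 2 * s = η * D := by simp only [s]; ring
    rw [e2] at hℓ
    have h1 := hpath _ _ _ hℓ
    have h2 : 0 < s ^ (p - 1) := by positivity
    have h3 : s ^ (p - 1) * ((1 + η / 2) * D) ≤
        K * ∑ i ∈ Finset.range m, dist (x i) (x (i + 1)) ^ p := by
      rw [Finset.range_eq_Ico]
      have h4 := mul_le_mul_of_nonneg_left h1 h2.le
      have h5 : s ^ (p - 1) * ((1 + η / 2) * D) =
          s ^ (p - 1) * ((1 + η) * D) - s ^ (p - 1) * s := by simp only [s]; ring
      linarith
    refine le_trans ?_ h3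
    have h6 : D ^ p = D ^ (p - 1) * D := by
      rw [← Real.rpow_add_one' hD.le (by linarith), sub_add_cancel]
    calc D ^ p = 1 * (D ^ (p - 1) * D) := by rw [h6, one_mul]
      _ ≤ ((1 + η / 2) * (η / 2) ^ (p - 1)) * (D ^ (p - 1) * D) := by gcongr
      _ = s ^ (p - 1) * ((1 + η / 2) * D) := by
        rw [Real.mul_rpow (by positivity) hD.le]; ring

/-! ### Assembly. -/

theorem tfae_biLipschitzToSnowflake {X : Type u} [MetricSpace X] {ω : Ultrafilter ℕ}
    (hω : IsNonprincipal ω) :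
    List.TFAE [BiLipschitzToSnowflake X, NoRectifiableCurves ω X, NoGeodesics ω X,
      SatisfiesSomeSRA X, ¬ LineFitting X] := by
  tfae_have 1 → 2 := fun h => h.satisfiesChainInequality.noRectifiableCurves ω
  tfae_have 2 → 3 := NoRectifiableCurves.noGeodesics
  tfae_have 3 → 4 := fun h =>
    satisfiesSomeSRA_iff.2 fun hap => hap.not_noGeodesics hω h
  tfae_have 4 ↔ 5 := by rw [satisfiesSomeSRA_iff, lineFitting_iff]
  tfae_have 4 → 1 := fun h =>
    (satisfiesChainInequality_of_not_hasApproxProgressions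
      h.not_hasApproxProgressions).biLipschitzToSnowflake
  tfae_finish

end SnowflakeChar

theorem theorem3p1 {X : Type u} [MetricSpace X] (ω : Ultrafilter ℕ)
    (hω : SnowflakeChar.IsNonprincipal ω) :
    List.TFAE
      [SnowflakeChar.BiLipschitzToSnowflake X,
        SnowflakeChar.NoRectifiableCurves ω X,
        SnowflakeChar.NoGeodesics ω X,
        SnowflakeChar.SatisfiesSomeSRA X,
        ¬ SnowflakeChar.LineFitting X] ∧
    ∀ (Y : Type v) [MetricSpace Y], SnowflakeChar.BiLipschitzEquivalent X Y →
      (SnowflakeChar.BiLipschitzToSnowflake X ↔ SnowflakeChar.BiLipschitzToSnowflake Y) ∧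
      (SnowflakeChar.NoRectifiableCurves ω X ↔ SnowflakeChar.NoRectifiableCurves ω Y) ∧
      (SnowflakeChar.NoGeodesics ω X ↔ SnowflakeChar.NoGeodesics ω Y) ∧
      (SnowflakeChar.SatisfiesSomeSRA X ↔ SnowflakeChar.SatisfiesSomeSRA Y) ∧
      (¬ SnowflakeChar.LineFitting X ↔ ¬ SnowflakeChar.LineFitting Y) := by
  have hX := SnowflakeChar.tfae_biLipschitzToSnowflake (X := X) hω
  refine ⟨hX, fun Y _ hXY => ?_⟩
  have hY := SnowflakeChar.tfae_biLipschitzToSnowflake (X := Y) hω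
  -- Invariance is needed for one condition only. The chain inequality mentions no auxiliary space,
  -- so it compares `X` and `Y` across universes.
  have h : SnowflakeChar.BiLipschitzToSnowflake X ↔ SnowflakeChar.BiLipschitzToSnowflake Y := by
    rw [SnowflakeChar.biLipschitzToSnowflake_iff, SnowflakeChar.biLipschitzToSnowflake_iff]
    exact hXY.satisfiesChainInequality_iff
  exact ⟨h, (hX.out 1 0).trans (h.trans (hY.out 0 1)), (hX.out 2 0).trans (h.trans (hY.out 0 2)),
    (hX.out 3 0).trans (h.trans (hY.out 0 3)), (hX.out 4 0).trans (h.trans (hY.out 0 4))⟩
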